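/- Let $K$ be an algebraically closed field. For $r,d\ge 1$ let $$X_{r,d}=V\Big(\sum_{i=1}^r\prod_{j=1}^d x_{ij}\Big)\subset\mathbb P^{rd-1}_K .$$ We say that the Fano scheme $\mathbf F_k(X_{r,d})$ of projective $k$-planes contained in $X_{r,d}$ is *$m$-split* if for every $k$-plane $L\subset X_{r,d}$ there are an integer $\lambda$ with $1\le\lambda\le m$ and indices $1\le a_1<\dots<a_\lambda\le r$ such that $L\subset V\big(\sum_{i=1}^{\lambda}\prod_{j=1}^d x_{a_ij}\big)$; one-split and two-split mean $m=1$ and $m=2$. The *product rank* $\mathrm{pr}(f)$ of a form $f$ of degree $d$ is the smallest $r$ such that $f$ is a sum of $r$ products of $d$ linear forms. **Theorem.** Let $f$ be an irreducible form of degree $d>1$ in $n+1$ variables over $K$ such that $V(f)\subset\mathbb P^n$ is not a cone (that is, there is no point $p$ such that $V(f)$ contains the line joining $p$ to each point of $V(f)$; equivalently, $f$ cannot be written in fewer than $n+1$ variables after a linear change of coordinates). Suppose that $V(f)$ is covered by $k$-planes, that is, every point of $V(f)$ lies on a $k$-plane contained in $V(f)$, and let $r\in\mathbb N$ with $rd\ge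 n+1$. 1. If $\mathbf F_k(X_{r,d})$ is one-split, then $\mathrm{pr}(f)\ne r$. 2. If $r$ is even, $k>n-r$, and the Fano schemes $$\mathbf F_k(X_{r,d}),\ \mathbf F_{k-d}(X_{r-2,d}),\ \dots,\ \mathbf F_{k-\frac{d(r-4)}2}(X_{4,d})$$ are two-split (that is, $\mathbf F_{k-ds}(X_{r-2s,d})$ is two-split for all integers $s\ge0$ with $r-2s\ge4$), then $\mathrm{pr}(f)\ne r$. -/

import Mathlib

namespace FanoSplit

variable {K : Type*} [Field K] {σ : Type*}

/-- The projective linear space `ℙ(W)`, for a linear subspace `W` of `K^σ`, is contained in the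
projective hypersurface `V(g)`. A projective `k`-plane is `ℙ(W)` with `W` of dimension `k + 1`. -/
def ContainedIn (W : Submodule K (σ → K)) (g : MvPolynomial σ K) : Prop :=
  ∀ w ∈ W, MvPolynomial.eval w g = 0

/-- The projective hypersurface `V(f)` is covered by `k`-planes: every point of `V(f)` lies on a
`k`-plane that is contained in `V(f)`. -/
def CoveredByPlanes (f : MvPolynomial σ K) (k : ℕ) : Prop :=
  ∀ x : σ → K, x ≠ 0 → MvPolynomial.eval x f = 0 →
    ∃ W : Submodule K (σ → K), Module.finrank K W = k + 1 ∧ x ∈ W ∧ ContainedIn W f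

/-- The projective hypersurface `V(f)` is a cone: there is a point `[v]` (a vertex) such that
`V(f)` contains the line joining `[v]` to any point of `V(f)`. -/
def IsCone (f : MvPolynomial σ K) : Prop :=
  ∃ v : σ → K, v ≠ 0 ∧ ∀ x : σ → K, MvPolynomial.eval x f = 0 →
    ∀ t : K, MvPolynomial.eval (x + t • v) f = 0

/-- `f` is a sum of `r` products of `d` linear forms (a linear form may be zero). -/
def IsSumOfProducts (d r : ℕ) (f : MvPolynomial σ K) : Prop :=
  ∃ l : Fin r → Fin d → MvPolynomial σ K,
    (∀ i j, (l i j).IsHomogeneous 1) ∧ f = ∑ i, ∏ j, l i j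

/-- The product rank (Chow rank) of a form `f` of degree `d`: the smallest `r` such that `f` is a
sum of `r` products of `d` linear forms. For `d ≥ 1` such an `r` exists for every form of degree
`d`, since every term of `f` is a product of `d` linear forms. -/
noncomputable def productRank (d : ℕ) (f : MvPolynomial σ K) : ℕ :=
  sInf {r : ℕ | IsSumOfProducts d r f}

/-- The polynomial `∑_{i ∈ A} x_{i1} ⋯ x_{id}` in the `rd` variables `x_{ij}`. -/
noncomputable def sumProd (K : Type*) [Field K] (r d : ℕ) (A : Finset (Fin r)) :
    MvPolynomial (Fin r × Fin d) K :=
  ∑ i ∈ A, ∏ j : Fin d, MvPolynomial.X (i, j)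

/-- The equation of the hypersurface `X_{r,d}` in `ℙ^{rd-1}`. -/
noncomputable def equationX (K : Type*) [Field K] (r d : ℕ) :
    MvPolynomial (Fin r × Fin d) K :=
  sumProd K r d Finset.univ

/-- The linear space `ℙ(W)` admits an `l`-splitting: there are indices `a₁ < ⋯ < a_l` such that it
is contained in the zero locus of `∑ i, x_{a_i 1} ⋯ x_{a_i d}`. -/
def HasSplitting {r d : ℕ} (W : Submodule K (Fin r × Fin d → K)) (l : ℕ) : Prop :=
  ∃ A : Finset (Fin r), A.card = l ∧ ContainedIn W (sumProd K r d A)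

/-- The Fano scheme of `k`-planes in `X_{r,d}` is `m`-split: every `k`-plane contained in `X_{r,d}`
admits an `l`-splitting for some `1 ≤ l ≤ m`. The dimension `k` is an integer, so that `k` may be
the value of a difference. -/
def FanoIsSplit (K : Type*) [Field K] (k : ℤ) (r d m : ℕ) : Prop :=
  ∀ W : Submodule K (Fin r × Fin d → K), (Module.finrank K W : ℤ) = k + 1 →
    ContainedIn W (equationX K r d) → ∃ l : ℕ, 1 ≤ l ∧ l ≤ m ∧ HasSplitting W l

end FanoSplit

namespace FanoSplit

open MvPolynomial

/-! A presentation of `f` by `r` products of linear forms is a linear map into `K^(rd)` pulling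
`X_{r,d}` back to `V(f)`. It is injective because `V(f)` is not a cone, so the `k`-planes covering
`V(f)` become `k`-planes in `X_{r,d}`. If these are `m`-split, each point of `V(f)` is a zero of a
partial sum of at most `m` products; as there are finitely many such sums and `f` is prime, `f`
divides one of them (`exists_dvd_partial_sum`). Minimality of the presentation then forces `r ≤ m`
(`card_le_of_dvd_partial_sum`). For `r = 1`, `f` would be reducible; for `r = 2`, `V(f)` would
contain a hyperplane. -/

/-- A linear form is evaluated by a linear functional. -/
lemma exists_linearMap_eval_eq {K σ : Type*} [Field K] {l : MvPolynomial σ K}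
    (hl : l.IsHomogeneous 1) : ∃ φ : (σ → K) →ₗ[K] K, ∀ x, φ x = eval x l := by
  have hl' : l ∈ homogeneousSubmodule σ K 1 := hl
  rw [homogeneousSubmodule_one_eq_span_X] at hl'
  induction hl' using Submodule.span_induction with
  | mem p hp =>
    obtain ⟨i, rfl⟩ := hp
    exact ⟨LinearMap.proj i, fun x => by simp⟩
  | zero => exact ⟨0, fun x => by simp⟩
  | add p q hp hq ihp ihq =>
    rw [← homogeneousSubmodule_one_eq_span_X] at hp hq
    obtain ⟨φ, hφ⟩ := ihp hp
    obtain ⟨ψ, hψ⟩ := ihq hq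
    exact ⟨φ + ψ, fun x => by simp [hφ, hψ]⟩
  | smul c p hp ih =>
    rw [← homogeneousSubmodule_one_eq_span_X] at hp
    obtain ⟨φ, hφ⟩ := ih hp
    exact ⟨c • φ, fun x => by simp [hφ, smul_eval]⟩

/-- A linear functional on a coordinate space is evaluation of a linear form. -/
lemma exists_isHomogeneous_one_eval_eq {K σ : Type*} [Field K] [Fintype σ]
    (φ : (σ → K) →ₗ[K] K) :
    ∃ l : MvPolynomial σ K, l.IsHomogeneous 1 ∧ ∀ x, eval x l = φ x := by
  classical
  refine ⟨∑ i, C (φ (Pi.single i 1)) * X i,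
    IsHomogeneous.sum _ _ _ fun i _ => isHomogeneous_C_mul_X _ _, fun x => ?_⟩
  conv_rhs => rw [LinearMap.pi_apply_eq_sum_univ φ x]
  simp only [map_sum, map_mul, eval_C, eval_X, smul_eq_mul]
  refine Finset.sum_congr rfl fun i _ => ?_
  rw [mul_comm]
  congr 2
  ext j
  simp [Pi.single_apply, eq_comm]

lemma eval_zero_of_isHomogeneous {K σ : Type*} [Field K] {d : ℕ} (hd : d ≠ 0)
    {f : MvPolynomial σ K} (hf : f.IsHomogeneous d) : eval (0 : σ → K) f = 0 := by
  have h := hf.coeff_eq_zero (d := 0) (by simpa using hd.symm)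
  rwa [← constantCoeff_eq, ← eval_zero'] at h

/-- The Nullstellensatz for the principal ideal of `f`, which need not be irreducible. -/
lemma exists_dvd_pow_of_forall_eval_eq_zero {K σ : Type*} [Field K] [IsAlgClosed K] [Finite σ]
    {f g : MvPolynomial σ K} (h : ∀ x, eval x f = 0 → eval x g = 0) : ∃ m : ℕ, f ∣ g ^ m := by
  have hg : g ∈ vanishingIdeal K (zeroLocus K (Ideal.span {f})) := fun x hx =>
    h x (hx f (Ideal.mem_span_singleton_self f))
  rw [vanishingIdeal_zeroLocus_eq_radical] at hg
  obtain ⟨m, hm⟩ := hg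
  exact ⟨m, Ideal.mem_span_singleton.mp hm⟩

/-- A polynomial vanishing on the zero locus of an irreducible polynomial is divisible by it. -/
lemma dvd_of_forall_eval_eq_zero {K σ : Type*} [Field K] [IsAlgClosed K] [Finite σ]
    {f g : MvPolynomial σ K} (hf : Irreducible f)
    (h : ∀ x, eval x f = 0 → eval x g = 0) : f ∣ g :=
  let ⟨_, hm⟩ := exists_dvd_pow_of_forall_eval_eq_zero h
  hf.prime.dvd_of_dvd_pow hm

/-- A form that divides a nonzero form has at most its degree. -/
lemma degree_le_of_dvd {K σ : Type*} [Field K] {f g : MvPolynomial σ K} {d e : ℕ}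
    (hf : f.IsHomogeneous d) (hg : g.IsHomogeneous e) (hg0 : g ≠ 0) (h : f ∣ g) : d ≤ e := by
  have hf0 : f ≠ 0 := by rintro rfl; exact hg0 (zero_dvd_iff.mp h)
  rw [← hf.totalDegree hf0, ← hg.totalDegree hg0]
  exact totalDegree_le_of_dvd_of_isDomain h hg0

/-- Forms of the same degree that divide one another are proportional. -/
lemma exists_eq_C_mul_of_dvd {K σ : Type*} [Field K] {f g : MvPolynomial σ K} {d : ℕ}
    (hf : f.IsHomogeneous d) (hg : g.IsHomogeneous d) (hg0 : g ≠ 0) (h : f ∣ g) :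
    ∃ c : K, f = C c * g := by
  obtain ⟨q, rfl⟩ := h
  have hf0 := left_ne_zero_of_mul hg0
  have hq0 := right_ne_zero_of_mul hg0
  have hdeg := totalDegree_mul_of_isDomain hf0 hq0
  rw [hg.totalDegree hg0, hf.totalDegree hf0] at hdeg
  obtain ⟨c, rfl⟩ : ∃ c, q = C c := ⟨_, totalDegree_eq_zero_iff_eq_C.mp (by omega)⟩
  have hc : c ≠ 0 := by rintro rfl; simp at hq0
  refine ⟨c⁻¹, ?_⟩
  rw [mul_left_comm, ← C_mul, inv_mul_cancel₀ hc, C_1, mul_one]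

lemma isSumOfProducts_finset_sum {K σ ι : Type*} [Field K] {d : ℕ}
    (l : ι → Fin d → MvPolynomial σ K) (hl : ∀ i j, (l i j).IsHomogeneous 1) (A : Finset ι) :
    IsSumOfProducts d A.card (∑ i ∈ A, ∏ j, l i j) := by
  refine ⟨fun i => l (A.equivFin.symm i), fun i j => hl _ j, ?_⟩
  rw [← Finset.sum_coe_sort A]
  exact (Equiv.sum_comp A.equivFin.symm fun i : A => ∏ j, l i j).symm

/-- The scalar is absorbed into the first factor of each product. -/
lemma IsSumOfProducts.C_mul {K σ : Type*} [Field K] {d r : ℕ} (hd : d ≠ 0)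
    {f : MvPolynomial σ K} (h : IsSumOfProducts d r f) (c : K) :
    IsSumOfProducts d r (C c * f) := by
  obtain ⟨e, rfl⟩ := Nat.exists_eq_succ_of_ne_zero hd
  obtain ⟨l, hl, rfl⟩ := h
  refine ⟨fun i => Fin.cons (C c * l i 0) fun j => l i j.succ, fun i j => ?_, ?_⟩
  · refine Fin.cases ?_ (fun j => ?_) j
    · exact (hl i 0).C_mul c
    · exact hl i j.succ
  · rw [Finset.mul_sum]
    refine Finset.sum_congr rfl fun i _ => ?_
    rw [Fin.prod_univ_succ, Fin.prod_univ_succ]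
    simp [mul_assoc]

/-- An irreducible form of degree `d > 1` is not a product of `d` linear forms. -/
lemma not_irreducible_prod {K σ : Type*} [Field K] {d : ℕ} (hd : 1 < d)
    {l : Fin d → MvPolynomial σ K} (hl : ∀ j, (l j).IsHomogeneous 1) :
    ¬ Irreducible (∏ j, l j) := by
  intro h
  obtain ⟨j, -, hj⟩ := h.prime.exists_mem_finset_dvd dvd_rfl
  have hj0 : l j ≠ 0 := Finset.prod_ne_zero_iff.mp h.ne_zero j (Finset.mem_univ j)
  have hprod : (∏ j, l j).IsHomogeneous d := by
    simpa using IsHomogeneous.prod Finset.univ l (fun _ => 1) fun j _ => hl j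
  have := degree_le_of_dvd hprod (hl j) hj0 hj
  omega

/-- The zero locus of an irreducible form of degree `d > 1` contains no hyperplane. -/
lemma finrank_lt_of_containedIn {K : Type*} [Field K] [IsAlgClosed K] {n d : ℕ} (hd : 1 < d)
    {f : MvPolynomial (Fin (n + 1)) K} (hf : f.IsHomogeneous d) (hirr : Irreducible f)
    {W : Submodule K (Fin (n + 1) → K)} (hW : ContainedIn W f) : Module.finrank K W < n := by
  by_contra! hn
  have hlt : W < ⊤ := by
    rw [lt_top_iff_ne_top]
    rintro rfl
    exact hirr.ne_zero (MvPolynomial.funext fun x => by simpa using hW x trivial)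
  obtain ⟨φ, hφ0, hφ⟩ := Submodule.exists_le_ker_of_lt_top W hlt
  have hker : W = LinearMap.ker φ := by
    refine Submodule.eq_of_le_of_finrank_le hφ ?_
    have := Module.Dual.finrank_ker_add_one_of_ne_zero hφ0
    rw [Module.finrank_fin_fun] at this
    omega
  obtain ⟨l, hl, hlφ⟩ := exists_isHomogeneous_one_eval_eq φ
  have hl0 : l ≠ 0 := by
    rintro rfl
    exact hφ0 (LinearMap.ext fun x => by simp [← hlφ])
  obtain ⟨m, hm⟩ := exists_dvd_pow_of_forall_eval_eq_zero (f := l) (g := f) fun x hx =>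
    hW x (by rwa [hker, LinearMap.mem_ker, ← hlφ])
  -- `l` is associated to `f ^ i`: a unit if `i = 0`, a multiple of `f` otherwise.
  obtain ⟨i, -, hi⟩ := (dvd_prime_pow hirr.prime m).mp hm
  rcases Nat.eq_zero_or_pos i with rfl | hi0
  · rw [pow_zero, associated_one_iff_isUnit] at hi
    have h0 := (hi.map (eval (0 : Fin (n + 1) → K))).ne_zero
    exact h0 (eval_zero_of_isHomogeneous one_ne_zero hl)
  · have := degree_le_of_dvd hf hl hl0 ((dvd_pow_self f hi0.ne').trans hi.symm.dvd)
    omega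

/-- A nonzero value rules out the default `sInf ∅ = 0`. -/
lemma isSumOfProducts_productRank {K σ : Type*} [Field K] {d : ℕ} {f : MvPolynomial σ K}
    (h : productRank d f ≠ 0) : IsSumOfProducts d (productRank d f) f :=
  Nat.sInf_mem (Nat.nonempty_of_pos_sInf (Nat.pos_of_ne_zero h))

lemma productRank_le {K σ : Type*} [Field K] {d r : ℕ} {f : MvPolynomial σ K}
    (h : IsSumOfProducts d r f) : productRank d f ≤ r :=
  Nat.sInf_le h

lemma exists_ne_zero_eval_eq_zero {K : Type*} [Field K] [IsAlgClosed K] {n d : ℕ} (hd : 1 < d)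
    {f : MvPolynomial (Fin (n + 1)) K} (hf : f.IsHomogeneous d) (hirr : Irreducible f) :
    ∃ x : Fin (n + 1) → K, x ≠ 0 ∧ eval x f = 0 := by
  by_contra! h
  have hdvd : f ∣ X 0 := dvd_of_forall_eval_eq_zero hirr fun x hx => by
    have : x = 0 := by_contra fun hx0 => h x hx0 hx
    simp [this]
  have := degree_le_of_dvd hf (isHomogeneous_X K 0) (X_ne_zero 0) hdvd
  omega

/-- If the `k`-planes in `X_{r,d}` split into at most `m` summands, then one of the partial sums of
a sum of products presenting `f` vanishes on all of `V(f)`, and so is divisible by `f`. -/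
lemma exists_dvd_partial_sum {K : Type*} [Field K] [IsAlgClosed K] {n d k r m : ℕ} (hd : 1 < d)
    {f : MvPolynomial (Fin (n + 1)) K} (hf : f.IsHomogeneous d) (hirr : Irreducible f)
    (hcone : ¬ IsCone f) (hcov : CoveredByPlanes f k)
    {l : Fin r → Fin d → MvPolynomial (Fin (n + 1)) K} (hl : ∀ i j, (l i j).IsHomogeneous 1)
    (hfl : f = ∑ i, ∏ j, l i j) (hsplit : FanoIsSplit K k r d m) :
    ∃ A : Finset (Fin r), A.Nonempty ∧ A.card ≤ m ∧ f ∣ ∑ i ∈ A, ∏ j, l i j := by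
  classical
  choose φ hφ using fun i j => exists_linearMap_eval_eq (hl i j)
  let Φ : (Fin (n + 1) → K) →ₗ[K] (Fin r × Fin d → K) := LinearMap.pi fun p => φ p.1 p.2
  have hΦ (A : Finset (Fin r)) (x : Fin (n + 1) → K) :
      eval (Φ x) (sumProd K r d A) = eval x (∑ i ∈ A, ∏ j, l i j) := by
    simp [sumProd, Φ, hφ, map_sum, map_prod]
  -- A nonzero kernel vector would be a vertex of `V(f)`.
  have hinj : Function.Injective Φ := by
    rw [← LinearMap.ker_eq_bot, LinearMap.ker_eq_bot']
    intro v hv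
    by_contra hv0
    refine hcone ⟨v, hv0, fun x hx t => ?_⟩
    rw [hfl, ← hΦ] at hx ⊢
    rwa [map_add, map_smul, hv, smul_zero, add_zero]
  have hplane (x : Fin (n + 1) → K) (hx0 : x ≠ 0) (hx : eval x f = 0) :
      ∃ A : Finset (Fin r), A.Nonempty ∧ A.card ≤ m ∧ eval x (∑ i ∈ A, ∏ j, l i j) = 0 := by
    obtain ⟨W, hWk, hxW, hWf⟩ := hcov x hx0 hx
    obtain ⟨c, hc, hcm, A, rfl, hA⟩ := hsplit (W.map Φ)
      (by rw [← (Submodule.equivMapOfInjective Φ hinj W).finrank_eq, hWk]; push_cast; rfl)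
      (by
        rintro _ ⟨w, hw, rfl⟩
        rw [equationX, hΦ, ← hfl]
        exact hWf w hw)
    exact ⟨A, Finset.card_pos.mp hc, hcm, by
      rw [← hΦ]; exact hA _ (Submodule.mem_map_of_mem hxW)⟩
  let S : Finset (Finset (Fin r)) := {A | A.Nonempty ∧ A.card ≤ m}
  obtain ⟨y, hy0, hy⟩ := exists_ne_zero_eval_eq_zero hd hf hirr
  have hdvd : f ∣ ∏ A ∈ S, ∑ i ∈ A, ∏ j, l i j := by
    refine dvd_of_forall_eval_eq_zero hirr fun x hx => ?_
    rw [map_prod, Finset.prod_eq_zero_iff]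
    -- The origin is not a projective point, so the covering says nothing there. All partial sums
    -- vanish at it, and `y` only serves to show `S` nonempty.
    by_cases hx0 : x = 0
    · obtain ⟨A, hA, hAm, -⟩ := hplane y hy0 hy
      refine ⟨A, by simp [S, hA, hAm], ?_⟩
      rw [hx0, map_sum]
      refine Finset.sum_eq_zero fun i _ => ?_
      rw [map_prod]
      exact Finset.prod_eq_zero (Finset.mem_univ ⟨0, by omega⟩)
        (eval_zero_of_isHomogeneous one_ne_zero (hl i _))
    · obtain ⟨A, hA, hAm, h⟩ := hplane x hx0 hx
      exact ⟨A, by simp [S, hA, hAm], h⟩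
  obtain ⟨A, hA, h⟩ := hirr.prime.exists_mem_finset_dvd hdvd
  simp only [S, Finset.mem_filter, Finset.mem_univ, true_and] at hA
  exact ⟨A, hA.1, hA.2, h⟩

/-- If a nonempty partial sum of a shortest presentation of `f` as a sum of products is divisible
by `f`, then it is not shorter than the whole sum. -/
lemma card_le_of_dvd_partial_sum {K σ : Type*} [Field K] {d r : ℕ} (hd : d ≠ 0)
    {f : MvPolynomial σ K} (hf : f.IsHomogeneous d) (hrank : r ≤ productRank d f)
    {l : Fin r → Fin d → MvPolynomial σ K} (hl : ∀ i j, (l i j).IsHomogeneous 1)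
    (hfl : f = ∑ i, ∏ j, l i j) {A : Finset (Fin r)} (hA : A.Nonempty)
    (hdvd : f ∣ ∑ i ∈ A, ∏ j, l i j) : r ≤ A.card := by
  classical
  -- A vanishing partial sum could be dropped, shortening the presentation; a nonzero one is a
  -- scalar multiple of `f`.
  by_cases h0 : ∑ i ∈ A, ∏ j, l i j = 0
  · have hc : f = ∑ i ∈ Aᶜ, ∏ j, l i j := by
      rw [hfl, ← Finset.sum_add_sum_compl A, h0, zero_add]
    have h := productRank_le (isSumOfProducts_finset_sum l hl Aᶜ)
    rw [← hc, Finset.card_compl, Fintype.card_fin] at h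
    have := hA.card_pos
    have := A.card_le_univ
    rw [Fintype.card_fin] at this
    omega
  · have hhom : (∑ i ∈ A, ∏ j, l i j).IsHomogeneous d :=
      IsHomogeneous.sum _ _ _ fun i _ => by
        simpa using IsHomogeneous.prod Finset.univ (l i) (fun _ => 1) fun j _ => hl i j
    obtain ⟨c, hc⟩ := exists_eq_C_mul_of_dvd hf hhom h0 hdvd
    have h := (isSumOfProducts_finset_sum l hl A).C_mul hd c
    rw [← hc] at h
    exact hrank.trans (productRank_le h)

end FanoSplit

theorem mainTheorem3 {K : Type*} [Field K] [IsAlgClosed K] (n d k r : ℕ) (hd : 1 < d)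
    (f : MvPolynomial (Fin (n + 1)) K) (hf : f.IsHomogeneous d) (hirr : Irreducible f)
    (hcone : ¬ FanoSplit.IsCone f) (hcov : FanoSplit.CoveredByPlanes f k)
    (hr : n + 1 ≤ r * d) :
    (FanoSplit.FanoIsSplit K k r d 1 → FanoSplit.productRank d f ≠ r) ∧
    (Even r → (n : ℤ) - r < k →
      (∀ s : ℕ, 2 * s + 4 ≤ r →
        FanoSplit.FanoIsSplit K ((k : ℤ) - d * s) (r - 2 * s) d 2) →
      FanoSplit.productRank d f ≠ r) := by
  have hr0 : 0 < r := Nat.pos_of_ne_zero (by rintro rfl; omega)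
  have hsum (h : FanoSplit.productRank d f = r) : FanoSplit.IsSumOfProducts d r f :=
    h ▸ FanoSplit.isSumOfProducts_productRank (by omega)
  have key (m : ℕ) (hs : FanoSplit.FanoIsSplit K k r d m)
      (h : FanoSplit.productRank d f = r) : r ≤ m := by
    obtain ⟨l, hl, hfl⟩ := hsum h
    obtain ⟨A, hA, hAm, hdvd⟩ :=
      FanoSplit.exists_dvd_partial_sum hd hf hirr hcone hcov hl hfl hs
    exact (FanoSplit.card_le_of_dvd_partial_sum (by omega) hf h.ge hl hfl hA hdvd).trans hAm
  refine ⟨fun hs h => ?_, fun heven hk hs h => ?_⟩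
  · obtain rfl : r = 1 := by have := key 1 hs h; omega
    obtain ⟨l, hl, hfl⟩ := hsum h
    rw [Fin.sum_univ_one] at hfl
    exact FanoSplit.not_irreducible_prod hd (hl 0) (hfl ▸ hirr)
  · have hr2 : r ≤ 2 := by
      by_contra! hr2
      obtain ⟨t, rfl⟩ := heven
      have := key 2 (by simpa using hs 0 (by omega)) h
      omega
    obtain rfl : r = 2 := by obtain ⟨t, rfl⟩ := heven; omega
    -- With `r = 2`, `k > n - 2` gives `finrank K W = k + 1 ≥ n`.
    obtain ⟨x, hx0, hx⟩ := FanoSplit.exists_ne_zero_eval_eq_zero hd hf hirr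
    obtain ⟨W, hWk, -, hWf⟩ := hcov x hx0 hx
    have := FanoSplit.finrank_lt_of_containedIn hd hf hirr hWf
    push_cast at hk
    omega
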